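/- For a complex number $q$ with $|q|<1$ and $s\in\mathbb{C}$ let $$L_q(s)=\sum_{n=1}^{\infty}\frac{n^{s}q^{n}}{1-q^{n}}$$ be the Lambert series, and let $B_m$ denote the $m$-th Bernoulli number. For integers $k\ge 1$ and $0\le j\le k$ put $$a_k=2^{4k+1}-(-1)^k2^{2k}-1,$$ $$b_{jk}=\frac{2^{2j-1}\left[1+(1+i)^{4k+1-2j}\right]-2^{4k+1-2j}\left[1+(1+i)^{2j-1}\right]}{a_k}\in\mathbb{C}.$$ Then for every integer $k\ge 1$ we have $a_k\neq 0$, the series defining $L_{e^{-2\pi}}(-4k-1)$ and $L_{e^{-4\pi}}(-4k-1)$ converge absolutely, and $$\zeta(4k+1)=(2\pi)^{4k+1}\sum_{j=0}^{k}\frac{(-1)^{j+1}\,b_{jk}\,B_{2j}\,B_{4k+2-2j}}{(2j)!\,(4k+2-2j)!}-\frac{2a_k+4}{a_k}\,L_{e^{-2\pi}}(-4k-1)+\frac{4}{a_k}\,L_{e^{-4\pi}}(-4k-1).$$ -/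

import Mathlib

/-- The `n`-th term `n ^ s * q ^ n / (1 - q ^ n)`, `n ≥ 1`, of the Lambert series. -/
noncomputable def lambertTerm (q s : ℂ) (n : ℕ+) : ℂ :=
  (n : ℂ) ^ s * q ^ (n : ℕ) / (1 - q ^ (n : ℕ))

/-- The Lambert series `L_q(s) = ∑_{n ≥ 1} n ^ s * q ^ n / (1 - q ^ n)`, for `|q| < 1`. -/
noncomputable def lambertL (q s : ℂ) : ℂ :=
  ∑' n : ℕ+, lambertTerm q s n

/-- `a_k = 2 ^ (4k+1) - (-1) ^ k * 2 ^ (2k) - 1`. -/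
noncomputable def zetaCoeffA (k : ℕ) : ℂ :=
  2 ^ (4 * k + 1) - (-1) ^ k * 2 ^ (2 * k) - 1

/-- The complex number
`b_{jk} = (2^(2j-1) (1 + (1+i)^(4k+1-2j)) - 2^(4k+1-2j) (1 + (1+i)^(2j-1))) / a_k`;
all exponents are integers (`2j - 1 = -1` for `j = 0`). -/
noncomputable def zetaCoeffB (j k : ℕ) : ℂ :=
  ((2 : ℂ) ^ (2 * (j : ℤ) - 1) * (1 + (1 + Complex.I) ^ (4 * (k : ℤ) + 1 - 2 * (j : ℤ)))
    - (2 : ℂ) ^ (4 * (k : ℤ) + 1 - 2 * (j : ℤ)) * (1 + (1 + Complex.I) ^ (2 * (j : ℤ) - 1)))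
    / zetaCoeffA k

open Complex

/-! Put `F(τ) = ζ(4k+1) + 2 L(e^{2πiτ})`, with `L` the Lambert series of exponent `-4k-1`. Expanding
`π cot(πmτ)` once in powers of `e^{2πiτ}` and once in partial fractions turns `F(τ)` into a double
sum over `(m, l)`. Exchanging `m` and `l` replaces `τ` by `-1/τ`, and the difference of the two
summands is a finite geometric sum, i.e. products of even zeta values (`lambertInvPow_reciprocity`,
`ramanujan_formula`). At `τ = 2i` and `τ = 1+i` this links `e^{-4π}` to `e^{-π}` and `e^{-2π}` to
`-e^{-π}`. Weighting the second relation by `(-4)^k` gives `L(e^{-π})` and `L(-e^{-π})` the same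
factor `2^{4k}`, and `lambertInvPow_add_lambertInvPow_neg` rewrites their sum by `L(e^{-2π})` and
`L(e^{-4π})`. The total coefficient of `ζ(4k+1)` is then `-a_k`. -/

/-- The Lambert series `∑_{n ≥ 1} n ^ (-N) q ^ n / (1 - q ^ n)` with integral exponent. -/
noncomputable def lambertInvPow (N : ℕ) (q : ℂ) : ℂ :=
  ∑' n : ℕ+, ((n : ℂ) ^ N)⁻¹ * (q ^ (n : ℕ) / (1 - q ^ (n : ℕ)))

theorem hasSum_pnat_inv_pow {N : ℕ} (hN : 1 < N) :
    HasSum (fun n : ℕ+ ↦ ((n : ℂ) ^ N)⁻¹) (riemannZeta N) := by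
  have hs : Summable (fun n : ℕ ↦ 1 / (n : ℂ) ^ N) := by
    exact Summable.of_norm (by simpa using Real.summable_one_div_nat_pow.mpr hN)
  have h := hs.hasSum
  rw [← zeta_nat_eq_tsum_of_gt_one hN] at h
  have h0 : N ≠ 0 := by lia
  rw [hasSum_pnat_iff (f := fun n : ℕ ↦ ((n : ℂ) ^ N)⁻¹)]
  simpa [h0] using h

theorem summable_norm_pnat_inv_pow {N : ℕ} (hN : 1 < N) :
    Summable (fun n : ℕ+ ↦ ‖((n : ℂ) ^ N)⁻¹‖) :=
  (hasSum_pnat_inv_pow hN).summable.norm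

theorem summable_lambertInvPow (N : ℕ) {q : ℂ} (hq : ‖q‖ < 1) :
    Summable (fun n : ℕ+ ↦ ((n : ℂ) ^ N)⁻¹ * (q ^ (n : ℕ) / (1 - q ^ (n : ℕ)))) := by
  have hg : Summable (fun n : ℕ+ ↦ ‖q‖ ^ (n : ℕ) / (1 - ‖q‖)) :=
    (((summable_geometric_of_lt_one (norm_nonneg q) hq).comp_injective
      PNat.coe_injective).div_const _)
  refine Summable.of_norm_bounded hg fun n ↦ ?_
  have h1 : ‖((n : ℂ) ^ N)⁻¹‖ ≤ 1 := by
    rw [norm_inv, norm_pow, norm_natCast]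
    exact inv_le_one_of_one_le₀ (one_le_pow₀ (by exact_mod_cast n.pos))
  have h2 : 1 - ‖q‖ ≤ ‖1 - q ^ (n : ℕ)‖ := by
    have := norm_sub_norm_le (1 : ℂ) (q ^ (n : ℕ))
    rw [norm_one, norm_pow] at this
    have h3 : ‖q‖ ^ (n : ℕ) ≤ ‖q‖ := pow_le_of_le_one (norm_nonneg q) hq.le n.ne_zero
    linarith
  have h4 : 0 < 1 - ‖q‖ := by linarith
  rw [norm_mul, norm_div, norm_pow]
  calc _ ≤ 1 * (‖q‖ ^ (n : ℕ) / ‖1 - q ^ (n : ℕ)‖) := by gcongr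
    _ ≤ _ := by rw [one_mul]; gcongr

theorem one_sub_pow_ne_zero_of_norm_lt_one {q : ℂ} (hq : ‖q‖ < 1) {n : ℕ} (hn : n ≠ 0) :
    1 - q ^ n ≠ 0 := by
  intro h
  have h1 : ‖q ^ n‖ = 1 := by rw [← sub_eq_zero.mp h, norm_one]
  rw [norm_pow] at h1
  exact (pow_lt_one₀ (norm_nonneg q) hq hn).ne h1

/-- Action of the Hecke operator at `2` on the Lambert series. -/
theorem lambertInvPow_add_lambertInvPow_neg (N : ℕ) {q : ℂ} (hq : ‖q‖ < 1) :
    lambertInvPow N q + lambertInvPow N (-q) =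
      2 * (1 + (2 ^ N)⁻¹) * lambertInvPow N (q ^ 2)
        - 2 * (2 ^ N)⁻¹ * lambertInvPow N (q ^ 4) := by
  have hq' : ‖-q‖ < 1 := by rwa [norm_neg]
  have hq2 : ‖q ^ 2‖ < 1 := by rw [norm_pow]; exact pow_lt_one₀ (norm_nonneg q) hq two_ne_zero
  have hq4 : ‖q ^ 4‖ < 1 := by rw [norm_pow]; exact pow_lt_one₀ (norm_nonneg q) hq (by simp)
  let t : ℂ → ℕ+ → ℂ := fun q n ↦ ((n : ℂ) ^ N)⁻¹ * (q ^ (n : ℕ) / (1 - q ^ (n : ℕ)))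
  have ht : ∀ p : ℂ, ‖p‖ < 1 → HasSum (t p) (lambertInvPow N p) :=
    fun p hp ↦ (summable_lambertInvPow N hp).hasSum
  have hinj : Function.Injective (fun m : ℕ+ ↦ 2 * m) := mul_right_injective 2
  have h1 : HasSum (fun n ↦ t q n + t (-q) n - 2 * t (q ^ 2) n)
      (lambertInvPow N q + lambertInvPow N (-q) - 2 * lambertInvPow N (q ^ 2)) :=
    ((ht q hq).add (ht _ hq')).sub ((ht _ hq2).mul_left 2)
  have h2 : HasSum (fun m ↦ 2 * (2 ^ N)⁻¹ * t (q ^ 2) m - 2 * (2 ^ N)⁻¹ * t (q ^ 4) m)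
      (2 * (2 ^ N)⁻¹ * lambertInvPow N (q ^ 2) - 2 * (2 ^ N)⁻¹ * lambertInvPow N (q ^ 4)) :=
    ((ht _ hq2).mul_left _).sub ((ht _ hq4).mul_left _)
  -- The combined series is supported on even `n`: for odd `n`, with `x = q^n`, `x/(1-x) - x/(1+x) =
  -- 2x²/(1-x²)`.
  rw [← hinj.hasSum_iff] at h1
  · have h3 : ((fun n ↦ t q n + t (-q) n - 2 * t (q ^ 2) n) ∘ fun m : ℕ+ ↦ 2 * m) =
        fun m ↦ 2 * (2 ^ N)⁻¹ * t (q ^ 2) m - 2 * (2 ^ N)⁻¹ * t (q ^ 4) m := by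
      ext m
      have e : ((2 * m : ℕ+) : ℕ) = 2 * (m : ℕ) := rfl
      simp only [t, Function.comp, e, Nat.cast_mul, Nat.cast_ofNat, mul_pow, mul_inv, pow_mul,
        neg_sq]
      rw [show q ^ 4 = (q ^ 2) ^ 2 by ring]
      ring
    rw [h3] at h1
    have := h1.unique h2
    linear_combination this
  · intro n hn
    have hodd : Odd (n : ℕ) := by
      rw [← Nat.not_even_iff_odd]
      rintro ⟨r, hr⟩
      have hr0 : 0 < r := by have := n.pos; lia
      exact hn ⟨⟨r, hr0⟩, PNat.eq (by rw [hr, ← two_mul]; rfl)⟩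
    have a1 := one_sub_pow_ne_zero_of_norm_lt_one hq n.ne_zero
    have a2 := one_sub_pow_ne_zero_of_norm_lt_one hq' n.ne_zero
    have a3 := one_sub_pow_ne_zero_of_norm_lt_one hq2 n.ne_zero
    simp only [t]
    rw [hodd.neg_pow] at a2 ⊢
    rw [pow_right_comm] at a3 ⊢
    rw [show 1 - (q ^ (n : ℕ)) ^ 2 = (1 - q ^ (n : ℕ)) * (1 - -q ^ (n : ℕ)) by ring]
    field_simp
    ring

/-! ### Two expansions of the cotangent -/

theorem norm_exp_two_pi_mul_I_lt_one {τ : ℂ} (hτ : 0 < τ.im) :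
    ‖exp (2 * Real.pi * I * τ)‖ < 1 :=
  UpperHalfPlane.norm_exp_two_pi_I_lt_one ⟨τ, hτ⟩

theorem pi_mul_cot_pi_mul_eq_exp {z : ℂ} (hz : 0 < z.im) :
    Real.pi * cot (Real.pi * z) = -(Real.pi * I) *
      (1 + 2 * (exp (2 * Real.pi * I * z) / (1 - exp (2 * Real.pi * I * z)))) := by
  have h := pi_mul_cot_pi_q_exp ⟨z, hz⟩
  have hlt := norm_exp_two_pi_mul_I_lt_one hz
  have hne := one_sub_pow_ne_zero_of_norm_lt_one hlt one_ne_zero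
  rw [pow_one] at hne
  change Real.pi * cot (Real.pi * z) = Real.pi * I - 2 * Real.pi * I *
    ∑' n : ℕ, exp (2 * Real.pi * I * z) ^ n at h
  rw [h, tsum_geometric_of_norm_lt_one hlt]
  generalize exp (2 * Real.pi * I * z) = x at hne
  field_simp
  ring

theorem pnat_mul_im_pos {τ : ℂ} (hτ : 0 < τ.im) (m : ℕ+) : 0 < ((m : ℂ) * τ).im := by
  have : 0 < (m : ℝ) := by exact_mod_cast m.pos
  simpa using mul_pos this hτ

/-- The series `∑ m ^ (-N) π cot (π m τ)` is, up to a factor, `ζ(N) + 2 ∑ n ^ (-N) q ^ n / (1 - q ^ n)`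
with `q = exp (2 π i τ)`. -/
theorem hasSum_inv_pow_mul_cot {N : ℕ} (hN : 1 < N) {τ : ℂ} (hτ : 0 < τ.im) :
    HasSum (fun m : ℕ+ ↦ ((m : ℂ) ^ N)⁻¹ * (Real.pi * cot (Real.pi * (m * τ))))
      (-(Real.pi * I) * (riemannZeta N + 2 * lambertInvPow N (exp (2 * Real.pi * I * τ)))) := by
  have h := ((hasSum_pnat_inv_pow hN).add ((summable_lambertInvPow N
    (norm_exp_two_pi_mul_I_lt_one hτ)).hasSum.mul_left 2)).mul_left (-(Real.pi * I))
  refine h.congr_fun ?_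
  intro m
  rw [pi_mul_cot_pi_mul_eq_exp (pnat_mul_im_pos hτ m), ← exp_nat_mul,
    show 2 * Real.pi * I * (m * τ) = ((m : ℕ) : ℂ) * (2 * Real.pi * I * τ) by ring]
  ring

theorem pi_mul_cot_pi_mul_eq_tsum {z : ℂ} (hz : 0 < z.im) :
    Real.pi * cot (Real.pi * z) = 1 / z + ∑' l : ℕ+, 2 * z / (z ^ 2 - (l : ℂ) ^ 2) := by
  rw [cot_series_rep (UpperHalfPlane.coe_mem_integerComplement ⟨z, hz⟩)]
  congr 1
  refine tsum_congr fun l ↦ ?_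
  have h1 : z - l ≠ 0 := fun h ↦ by
    have := congrArg im h
    simp at this
    linarith
  have h2 : z + l ≠ 0 := fun h ↦ by
    have := congrArg im h
    simp at this
    linarith
  rw [show z ^ 2 - (l : ℂ) ^ 2 = (z - l) * (z + l) by ring]
  field_simp
  ring

/-! ### The double series and its reciprocity -/

/-- For `Re (τ ^ 2) ≤ 0` the quadratic form `x ^ 2 τ ^ 2 - y ^ 2` dominates `y ^ 2`. -/
theorem sq_le_norm_sq_mul_sub_sq {τ : ℂ} (hτ : (τ ^ 2).re ≤ 0) (x y : ℝ) :
    y ^ 2 ≤ ‖(x : ℂ) ^ 2 * τ ^ 2 - (y : ℂ) ^ 2‖ := by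
  refine le_trans ?_ ((neg_le_abs _).trans (abs_re_le_norm _))
  have : ((x : ℂ) ^ 2 * τ ^ 2 - (y : ℂ) ^ 2).re = x ^ 2 * (τ ^ 2).re - y ^ 2 := by
    rw [sub_re, ← ofReal_pow, ← ofReal_pow, re_ofReal_mul, ofReal_re]
  rw [this]
  nlinarith [mul_nonneg (sq_nonneg x) (neg_nonneg.mpr hτ)]

theorem pnat_sq_mul_sub_sq_ne_zero {τ : ℂ} (hτ : (τ ^ 2).re ≤ 0) (m l : ℕ+) :
    (m : ℂ) ^ 2 * τ ^ 2 - (l : ℂ) ^ 2 ≠ 0 := by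
  have h := sq_le_norm_sq_mul_sub_sq hτ m l
  have hl : (0 : ℝ) < (l : ℝ) ^ 2 := by have := l.pos; positivity
  rw [← norm_pos_iff]
  simpa using hl.trans_le h

/-- The general term of the double series for `∑ m ^ (-(2 M + 1)) π cot (π m τ)`. -/
noncomputable def cotDoubleTerm (M : ℕ) (τ : ℂ) (p : ℕ+ × ℕ+) : ℂ :=
  ((p.1 : ℂ) ^ (2 * M))⁻¹ * (2 * τ / ((p.1 : ℂ) ^ 2 * τ ^ 2 - (p.2 : ℂ) ^ 2))

theorem summable_cotDoubleTerm {M : ℕ} (hM : 1 ≤ M) {τ : ℂ} (hτ : (τ ^ 2).re ≤ 0) :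
    Summable (cotDoubleTerm M τ) := by
  have h := ((summable_norm_pnat_inv_pow (N := 2 * M) (by lia)).mul_of_nonneg
    (summable_norm_pnat_inv_pow one_lt_two) (fun _ ↦ norm_nonneg _)
    (fun _ ↦ norm_nonneg _)).mul_left ‖2 * τ‖
  refine Summable.of_norm_bounded h fun p ↦ ?_
  have hp := sq_le_norm_sq_mul_sub_sq hτ p.1 p.2
  have hl : (0 : ℝ) < (p.2 : ℝ) ^ 2 := by have := p.2.pos; positivity
  simp only [ofReal_natCast] at hp
  rw [cotDoubleTerm, norm_mul, norm_div, norm_inv ((p.2 : ℂ) ^ 2), norm_pow (p.2 : ℂ),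
    norm_natCast]
  calc _ ≤ ‖((p.1 : ℂ) ^ (2 * M))⁻¹‖ * (‖2 * τ‖ / (p.2 : ℝ) ^ 2) := by gcongr
    _ = _ := by rw [div_eq_mul_inv]; ring

/-- Summing over `l` first gives the partial fractions of `π cot(πmτ)` without the pole term
`1/(mτ)`; these omitted terms add up to `ζ(2M+2)/τ`. -/
theorem hasSum_cotDoubleTerm {M : ℕ} (hM : 1 ≤ M) {τ : ℂ} (hτ : 0 < τ.im)
    (hτ2 : (τ ^ 2).re ≤ 0) :
    HasSum (cotDoubleTerm M τ)
      (-(Real.pi * I) * (riemannZeta (2 * M + 1 : ℕ) +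
          2 * lambertInvPow (2 * M + 1) (exp (2 * Real.pi * I * τ)))
        - riemannZeta (2 * M + 2 : ℕ) / τ) := by
  have hs := summable_cotDoubleTerm hM hτ2
  have hτ0 : τ ≠ 0 := by rintro rfl; simp at hτ
  have h1 := (hasSum_inv_pow_mul_cot (N := 2 * M + 1) (by lia) hτ).sub
    ((hasSum_pnat_inv_pow (N := 2 * M + 2) (by lia)).div_const τ)
  rw [← h1.tsum_eq]
  convert! hs.hasSum using 1
  rw [hs.tsum_prod]
  refine tsum_congr fun m ↦ ?_
  have hm : (m : ℂ) ≠ 0 := by exact_mod_cast m.ne_zero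
  rw [pi_mul_cot_pi_mul_eq_tsum (pnat_mul_im_pos hτ m), mul_add, ← tsum_mul_left]
  have h2 : ((m : ℂ) ^ (2 * M + 1))⁻¹ * (1 / (m * τ)) = ((m : ℂ) ^ (2 * M + 2))⁻¹ / τ := by
    field_simp
    ring
  rw [h2, add_sub_cancel_left]
  refine tsum_congr fun l ↦ ?_
  rw [cotDoubleTerm, mul_pow, pow_succ]
  field_simp

/-- Partial fractions: the geometric sum identity behind the reciprocity law. -/
theorem cotDoubleTerm_sub_swap (M : ℕ) {τ : ℂ} (hτ0 : τ ≠ 0) (hτ2 : (τ ^ 2).re ≤ 0)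
    (p : ℕ+ × ℕ+) :
    cotDoubleTerm M τ p - τ ^ (2 * M) * cotDoubleTerm M (-1 / τ) p.swap =
      ∑ i ∈ Finset.range M, -2 * τ ^ (2 * i + 1) *
        (((p.1 : ℂ) ^ (2 * M - 2 * i))⁻¹ * ((p.2 : ℂ) ^ (2 * i + 2))⁻¹) := by
  obtain ⟨m, l⟩ := p
  have hm : (m : ℂ) ≠ 0 := by exact_mod_cast m.ne_zero
  have hl : (l : ℂ) ≠ 0 := by exact_mod_cast l.ne_zero
  have hd := pnat_sq_mul_sub_sq_ne_zero hτ2 m l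
  have hgeom := geom_sum₂_mul ((m : ℂ) ^ 2 * τ ^ 2) ((l : ℂ) ^ 2) M
  have hsum : ∑ i ∈ Finset.range M, -2 * τ ^ (2 * i + 1) *
        (((m : ℂ) ^ (2 * M - 2 * i))⁻¹ * ((l : ℂ) ^ (2 * i + 2))⁻¹) =
      -2 * τ * ((m : ℂ) ^ (2 * M))⁻¹ * ((l : ℂ) ^ (2 * M))⁻¹ *
        ∑ i ∈ Finset.range M, ((m : ℂ) ^ 2 * τ ^ 2) ^ i * ((l : ℂ) ^ 2) ^ (M - 1 - i) := by
    rw [Finset.mul_sum]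
    refine Finset.sum_congr rfl fun i hi ↦ ?_
    obtain ⟨r, rfl⟩ : ∃ r, M = i + 1 + r := ⟨M - i - 1, by have := Finset.mem_range.mp hi; lia⟩
    rw [show 2 * (i + 1 + r) - 2 * i = 2 * r + 2 by lia, show i + 1 + r - 1 - i = r by lia]
    field_simp
    ring
  rw [hsum]
  -- The swapped term has the same denominator `m²τ² - l²`, so only the powers of `m` and `l`
  -- differ.
  have hsw : cotDoubleTerm M (-1 / τ) (Prod.swap (m, l)) =
      ((l : ℂ) ^ (2 * M))⁻¹ * (2 * τ / ((m : ℂ) ^ 2 * τ ^ 2 - (l : ℂ) ^ 2)) := by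
    have hd' : (l : ℂ) ^ 2 * (-1 / τ) ^ 2 - (m : ℂ) ^ 2 =
        -((m : ℂ) ^ 2 * τ ^ 2 - (l : ℂ) ^ 2) / τ ^ 2 := by
      field_simp
      ring
    simp only [cotDoubleTerm, Prod.swap_prod_mk]
    rw [hd']
    field_simp
  rw [hsw]
  simp only [cotDoubleTerm]
  rw [← eq_div_iff hd] at hgeom
  rw [hgeom, mul_pow, ← pow_mul, ← pow_mul, ← pow_mul]
  field_simp
  ring

theorem hasSum_pnat_prod_inv_pow {a b : ℕ} (ha : 1 < a) (hb : 1 < b) :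
    HasSum (fun p : ℕ+ × ℕ+ ↦ ((p.1 : ℂ) ^ a)⁻¹ * ((p.2 : ℂ) ^ b)⁻¹)
      (riemannZeta a * riemannZeta b) := by
  have hs := summable_mul_of_summable_norm (summable_norm_pnat_inv_pow ha)
    (summable_norm_pnat_inv_pow hb)
  have h := tsum_mul_tsum_of_summable_norm (summable_norm_pnat_inv_pow ha)
    (summable_norm_pnat_inv_pow hb)
  rw [(hasSum_pnat_inv_pow ha).tsum_eq, (hasSum_pnat_inv_pow hb).tsum_eq] at h
  rw [h]
  exact hs.hasSum

/-- Reciprocity for `ζ(2M + 1) + 2 ∑ n ^ (-2M-1) q ^ n / (1 - q ^ n)` under `τ ↦ -1 / τ`. -/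
theorem lambertInvPow_reciprocity {M : ℕ} (hM : 1 ≤ M) {τ : ℂ} (hτ : 0 < τ.im)
    (hτ2 : (τ ^ 2).re ≤ 0) :
    -(Real.pi * I) * ((riemannZeta (2 * M + 1 : ℕ) +
          2 * lambertInvPow (2 * M + 1) (exp (2 * Real.pi * I * τ)))
      - τ ^ (2 * M) * (riemannZeta (2 * M + 1 : ℕ) +
          2 * lambertInvPow (2 * M + 1) (exp (2 * Real.pi * I * (-1 / τ))))) =
      riemannZeta (2 * M + 2 : ℕ) * (τ⁻¹ + τ ^ (2 * M + 1)) -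
        2 * ∑ i ∈ Finset.range M, τ ^ (2 * i + 1) *
          (riemannZeta (2 * M - 2 * i : ℕ) * riemannZeta (2 * i + 2 : ℕ)) := by
  have hτ0 : τ ≠ 0 := by rintro rfl; simp at hτ
  have hσ : 0 < (-1 / τ).im := by
    rw [neg_div, one_div, neg_im, inv_im, neg_div, neg_neg]
    exact div_pos hτ (normSq_pos.mpr hτ0)
  -- The condition on `τ²` is stable under `τ ↦ -1/τ`, since inversion keeps the sign of the real
  -- part.
  have hσ2 : ((-1 / τ) ^ 2).re ≤ 0 := by
    rw [div_pow, neg_one_sq, one_div, inv_re]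
    exact div_nonpos_of_nonpos_of_nonneg hτ2 (normSq_nonneg _)
  have hswap : HasSum (fun p : ℕ+ × ℕ+ ↦ τ ^ (2 * M) * cotDoubleTerm M (-1 / τ) p.swap) _ :=
    (((Equiv.prodComm ℕ+ ℕ+).hasSum_iff.mpr (hasSum_cotDoubleTerm hM hσ hσ2))).mul_left _
  have h1 := (hasSum_cotDoubleTerm hM hτ hτ2).sub hswap
  rw [funext (cotDoubleTerm_sub_swap M hτ0 hτ2)] at h1
  have h2 : HasSum (fun p : ℕ+ × ℕ+ ↦ ∑ i ∈ Finset.range M, -2 * τ ^ (2 * i + 1) *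
        (((p.1 : ℂ) ^ (2 * M - 2 * i))⁻¹ * ((p.2 : ℂ) ^ (2 * i + 2))⁻¹))
      (∑ i ∈ Finset.range M, -2 * τ ^ (2 * i + 1) *
        (riemannZeta (2 * M - 2 * i : ℕ) * riemannZeta (2 * i + 2 : ℕ))) := by
    refine hasSum_sum fun i hi ↦ HasSum.mul_left _ ?_
    have hi' := Finset.mem_range.mp hi
    exact hasSum_pnat_prod_inv_pow (by lia) (by lia)
  have h3 := h1.unique h2
  have h4 : ∑ i ∈ Finset.range M, -2 * τ ^ (2 * i + 1) *
        (riemannZeta (2 * M - 2 * i : ℕ) * riemannZeta (2 * i + 2 : ℕ)) =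
      -2 * ∑ i ∈ Finset.range M, τ ^ (2 * i + 1) *
        (riemannZeta (2 * M - 2 * i : ℕ) * riemannZeta (2 * i + 2 : ℕ)) := by
    rw [Finset.mul_sum]
    exact Finset.sum_congr rfl fun i _ ↦ by ring
  rw [h4] at h3
  have h5 : riemannZeta (2 * M + 2 : ℕ) / (-1 / τ) = -(riemannZeta (2 * M + 2 : ℕ) * τ) := by
    field_simp
  rw [h5] at h3
  rw [div_eq_mul_inv] at h3
  linear_combination h3

/-! ### Ramanujan's formula in Bernoulli numbers -/

/-- The coefficient `B_{2j} B_{4k+2-2j} / ((2j)! (4k+2-2j)!)`. -/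
noncomputable def bernoulliProdCoeff (k j : ℕ) : ℂ :=
  (bernoulli (2 * j) : ℂ) * (bernoulli (4 * k + 2 - 2 * j) : ℂ) /
    ((Nat.factorial (2 * j) : ℂ) * (Nat.factorial (4 * k + 2 - 2 * j) : ℂ))

/-- Euler's formula for both factors. It also holds at argument `0`, where it gives `ζ(0) = -1/2`,
so the end indices need no separate case. -/
theorem riemannZeta_even_mul_riemannZeta_even {k j : ℕ} (hj : j ≤ 2 * k + 1) :
    riemannZeta (2 * j : ℕ) * riemannZeta (4 * k + 2 - 2 * j : ℕ) =
      -(2 ^ (4 * k) * (Real.pi : ℂ) ^ (4 * k + 2)) * bernoulliProdCoeff k j := by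
  obtain ⟨l, hl⟩ := Nat.exists_eq_add_of_le hj
  have he : 4 * k + 2 - 2 * j = 2 * l := by lia
  rw [bernoulliProdCoeff, he]
  have h1 := riemannZeta_two_mul_nat' (k := j)
  have h2 := riemannZeta_two_mul_nat' (k := l)
  push_cast
  rw [h1, h2]
  have h3 : (2 : ℂ) ^ (2 * (j : ℤ) - 1) * 2 ^ (2 * (l : ℤ) - 1) = 2 ^ (4 * k) := by
    rw [← zpow_add₀ two_ne_zero, ← zpow_natCast]
    congr 1
    push_cast
    lia
  have h4 : (Real.pi : ℂ) ^ (2 * j) * (Real.pi : ℂ) ^ (2 * l) = (Real.pi : ℂ) ^ (4 * k + 2) := by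
    rw [← pow_add]
    congr 1
    lia
  have h5 : (-1 : ℂ) ^ (j + 1) * (-1) ^ (l + 1) = -1 := by
    rw [← pow_add]
    exact Odd.neg_one_pow ⟨k + 1, by lia⟩
  rw [← h3, ← h4]
  linear_combination ((2 : ℂ) ^ (2 * (j : ℤ) - 1) * 2 ^ (2 * (l : ℤ) - 1) *
    ((Real.pi : ℂ) ^ (2 * j) * (Real.pi : ℂ) ^ (2 * l)) *
    ((bernoulli (2 * j) : ℂ) * (bernoulli (2 * l) : ℂ) /
      ((Nat.factorial (2 * j) : ℂ) * (Nat.factorial (2 * l) : ℂ)))) * h5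

theorem bernoulliProdCoeff_reflect {k j : ℕ} (hj : j ≤ 2 * k + 1) :
    bernoulliProdCoeff k (2 * k + 1 - j) = bernoulliProdCoeff k j := by
  rw [bernoulliProdCoeff, bernoulliProdCoeff, show 2 * (2 * k + 1 - j) = 4 * k + 2 - 2 * j by lia,
    show 4 * k + 2 - (4 * k + 2 - 2 * j) = 2 * j by lia]
  ring

theorem sum_range_two_mul_eq_sum_add_reflect {R : Type*} [AddCommMonoid R] (f : ℕ → R) (n : ℕ) :
    ∑ j ∈ Finset.range (2 * n), f j = ∑ j ∈ Finset.range n, (f j + f (2 * n - 1 - j)) := by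
  rw [two_mul, Finset.sum_range_add, Finset.sum_add_distrib,
    ← Finset.sum_range_reflect (fun j ↦ f (n + j))]
  congr 1
  refine Finset.sum_congr rfl fun j hj ↦ ?_
  have := Finset.mem_range.mp hj
  congr 1
  lia

/-- Ramanujan's formula for `ζ(4k + 1)`. -/
theorem ramanujan_formula {k : ℕ} (hk : 1 ≤ k) {τ : ℂ} (hτ : 0 < τ.im) (hτ2 : (τ ^ 2).re ≤ 0) :
    (riemannZeta (4 * k + 1 : ℕ) + 2 * lambertInvPow (4 * k + 1) (exp (2 * Real.pi * I * τ)))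
      - τ ^ (4 * k) * (riemannZeta (4 * k + 1 : ℕ) +
          2 * lambertInvPow (4 * k + 1) (exp (2 * Real.pi * I * (-1 / τ)))) =
      I * (2 * Real.pi) ^ (4 * k + 1) * ∑ j ∈ Finset.range (k + 1), bernoulliProdCoeff k j *
        (τ ^ (2 * (j : ℤ) - 1) + τ ^ (4 * (k : ℤ) + 1 - 2 * (j : ℤ))) := by
  have hτ0 : τ ≠ 0 := by rintro rfl; simp at hτ
  have h := lambertInvPow_reciprocity (M := 2 * k) (by lia) hτ hτ2
  rw [show 2 * (2 * k) = 4 * k by ring] at h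
  let f : ℕ → ℂ := fun j ↦ τ ^ (2 * (j : ℤ) - 1) *
    (riemannZeta (2 * j : ℕ) * riemannZeta (4 * k + 2 - 2 * j : ℕ))
  -- Because `ζ(0) = -1/2`, the isolated `ζ(4k+2)` terms of the reciprocity law become the end terms
  -- `j = 0` and `j = 2k+1` of a single sum.
  have h0 : f 0 = -(1 / 2) * τ⁻¹ * riemannZeta (4 * k + 2 : ℕ) := by
    simp only [f, mul_zero, Nat.cast_zero, riemannZeta_zero, zero_sub, zpow_neg_one, Nat.sub_zero]
    ring
  have hlast : f (2 * k + 1) = -(1 / 2) * τ ^ (4 * k + 1) * riemannZeta (4 * k + 2 : ℕ) := by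
    simp only [f]
    rw [show 2 * (2 * k + 1) = 4 * k + 2 by ring, Nat.sub_self, Nat.cast_zero, riemannZeta_zero,
      show 2 * ((2 * k + 1 : ℕ) : ℤ) - 1 = (4 * k + 1 : ℕ) by push_cast; ring, zpow_natCast]
    ring
  have hmid : ∑ i ∈ Finset.range (2 * k), f (i + 1) = ∑ i ∈ Finset.range (2 * k), τ ^ (2 * i + 1) *
      (riemannZeta (4 * k - 2 * i : ℕ) * riemannZeta (2 * i + 2 : ℕ)) := by
    refine Finset.sum_congr rfl fun i hi ↦ ?_
    simp only [f]
    rw [show 2 * ((i + 1 : ℕ) : ℤ) - 1 = (2 * i + 1 : ℕ) by push_cast; ring, zpow_natCast,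
      show 4 * k + 2 - 2 * (i + 1) = 4 * k - 2 * i by lia, show 2 * (i + 1) = 2 * i + 2 by ring,
      mul_comm (riemannZeta _)]
  have hsum : ∑ j ∈ Finset.range (2 * (k + 1)), f j =
      -(2 ^ (4 * k) * (Real.pi : ℂ) ^ (4 * k + 2)) * ∑ j ∈ Finset.range (k + 1),
        bernoulliProdCoeff k j * (τ ^ (2 * (j : ℤ) - 1) + τ ^ (4 * (k : ℤ) + 1 - 2 * (j : ℤ))) := by
    -- The coefficients are symmetric under `j ↦ 2k+1-j`, which folds the sum to `j ≤ k`.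
    rw [sum_range_two_mul_eq_sum_add_reflect, Finset.mul_sum]
    refine Finset.sum_congr rfl fun j hj ↦ ?_
    have hj' := Finset.mem_range.mp hj
    rw [show 2 * (k + 1) - 1 - j = 2 * k + 1 - j by lia]
    simp only [f]
    rw [riemannZeta_even_mul_riemannZeta_even (by lia),
      riemannZeta_even_mul_riemannZeta_even (by lia), bernoulliProdCoeff_reflect (by lia),
      show 2 * ((2 * k + 1 - j : ℕ) : ℤ) - 1 = 4 * (k : ℤ) + 1 - 2 * (j : ℤ) by lia]
    ring
  rw [show 2 * (k + 1) = 2 * k + 1 + 1 by ring, Finset.sum_range_succ, Finset.sum_range_succ',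
    h0, hlast, hmid] at hsum
  have hπ : (Real.pi : ℂ) ≠ 0 := by exact_mod_cast Real.pi_ne_zero
  have hne : -(Real.pi * I) ≠ 0 := neg_ne_zero.mpr (mul_ne_zero hπ I_ne_zero)
  refine mul_left_cancel₀ hne (h.trans ?_)
  rw [mul_pow]
  linear_combination (-2) * hsum - 2 * 2 ^ (4 * k) * (Real.pi : ℂ) ^ (4 * k + 2) *
    (∑ j ∈ Finset.range (k + 1), bernoulliProdCoeff k j *
      (τ ^ (2 * (j : ℤ) - 1) + τ ^ (4 * (k : ℤ) + 1 - 2 * (j : ℤ)))) * (-I_sq)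

/-! ### Specialization at `2i` and `1 + i` -/

theorem zetaCoeffA_ne_zero {k : ℕ} (hk : 1 ≤ k) : zetaCoeffA k ≠ 0 := by
  obtain ⟨r, rfl⟩ := Nat.exists_eq_add_of_le hk
  -- For `k ≥ 1`, `a_k` is an odd integer.
  have h : zetaCoeffA (1 + r) =
      ((2 * (2 ^ (4 * (1 + r)) - (-1) ^ (1 + r) * 2 ^ (2 * r + 1)) - 1 : ℤ) : ℂ) := by
    rw [zetaCoeffA]
    push_cast
    ring
  rw [h]
  exact_mod_cast (by lia)

theorem lambertTerm_neg_nat (k : ℕ) (q : ℂ) :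
    lambertTerm q (-4 * (k : ℂ) - 1) =
      fun n : ℕ+ ↦ ((n : ℂ) ^ (4 * k + 1))⁻¹ * (q ^ (n : ℕ) / (1 - q ^ (n : ℕ))) := by
  ext n
  rw [lambertTerm, show -4 * (k : ℂ) - 1 = -((4 * k + 1 : ℕ) : ℂ) by push_cast; ring, cpow_neg,
    cpow_natCast, mul_div_assoc]

theorem lambertL_neg_nat (k : ℕ) (q : ℂ) :
    lambertL q (-4 * (k : ℂ) - 1) = lambertInvPow (4 * k + 1) q := by
  rw [lambertL, lambertTerm_neg_nat, lambertInvPow]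

theorem one_add_I_sq : (1 + I) ^ 2 = 2 * I := by
  linear_combination I_sq

/-- The powers occurring in `b_{jk}` expressed by those occurring in Ramanujan's formula at
`2i` and `1 + i`. -/
theorem zetaCoeffB_mul {j k : ℕ} (hk : 1 ≤ k) (hj : j ≤ k) :
    (-1) ^ (j + 1) * zetaCoeffB j k * zetaCoeffA k =
      -(I * ((2 * I) ^ (2 * (j : ℤ) - 1) + (2 * I) ^ (4 * (k : ℤ) + 1 - 2 * (j : ℤ))) +
        (-4) ^ k * I *
          ((1 + I) ^ (2 * (j : ℤ) - 1) + (1 + I) ^ (4 * (k : ℤ) + 1 - 2 * (j : ℤ)))) := by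
  have ha := zetaCoeffA_ne_zero hk
  obtain ⟨s, rfl⟩ := Nat.exists_eq_add_of_le hj
  have hw : (1 + I) ≠ 0 := fun h ↦ by simpa using congrArg im h
  have h2I : 2 * I ≠ 0 := by simp
  have hminus : ∀ x : ℂ, x ≠ 0 → x ^ (2 * (j : ℤ) - 1) = (x ^ 2) ^ j * x⁻¹ := fun x hx ↦ by
    rw [zpow_sub_one₀ hx, zpow_mul]
    norm_cast
  have hplus : ∀ x : ℂ, x ^ (4 * ((j + s : ℕ) : ℤ) + 1 - 2 * (j : ℤ)) =
      (x ^ 2) ^ j * ((x ^ 2) ^ 2) ^ s * x := fun x ↦ by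
    rw [show 4 * ((j + s : ℕ) : ℤ) + 1 - 2 * (j : ℤ) = (2 * j + 4 * s + 1 : ℕ) by push_cast; ring,
      zpow_natCast]
    ring
  have hwinv : (1 + I)⁻¹ = (1 - I) / 2 := by
    rw [inv_eq_iff_eq_inv, inv_div, eq_div_iff]
    · linear_combination -I_sq
    · intro h
      simpa using congrArg im h
  have h2Iinv : (2 * I)⁻¹ = -I / 2 := by
    rw [mul_inv, inv_I]
    ring
  rw [zetaCoeffB, mul_assoc, div_mul_cancel₀ _ ha, hminus 2 two_ne_zero, hminus _ hw,
    hminus _ h2I, hplus, hplus, hplus, one_add_I_sq, hwinv, h2Iinv]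
  have e1 : (2 * I) ^ 2 = -4 := by linear_combination 4 * I_sq
  rw [e1]
  have e2 : ((-1 : ℂ) ^ s) ^ 2 = 1 := by rw [← pow_mul, mul_comm, pow_mul]; simp
  have e3 : (-1 : ℂ) ^ j = (I ^ j) ^ 2 := by rw [← pow_mul, mul_comm, pow_mul, I_sq]
  have e4 : (4 : ℂ) ^ j = (2 ^ j) ^ 2 := by rw [← pow_mul, mul_comm, pow_mul]; norm_num
  have e5 : (4 : ℂ) ^ s = (2 ^ s) ^ 2 := by rw [← pow_mul, mul_comm, pow_mul]; norm_num
  have e6 : (16 : ℂ) ^ s = (2 ^ s) ^ 4 := by rw [← pow_mul, mul_comm, pow_mul]; norm_num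
  have e7 : ((-4 : ℂ)) ^ j = (-1) ^ j * 4 ^ j := by rw [← mul_pow]; norm_num
  have e8 : ((-4 : ℂ)) ^ s = (-1) ^ s * 4 ^ s := by rw [← mul_pow]; norm_num
  norm_num only
  simp only [pow_succ (-1 : ℂ) j, pow_add, mul_pow, e7, e8, e3, e4, e5, e6]
  -- What remains is a polynomial identity modulo `I² = -1` and `E² = 1`.
  generalize I ^ j = J at *
  generalize (2 : ℂ) ^ j = T at *
  generalize (2 : ℂ) ^ s = V at *
  generalize (-1 : ℂ) ^ s = E at *
  linear_combination (-1 / 2 * J ^ 2 * T ^ 2 + 2 * J ^ 2 * T ^ 2 * V ^ 4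
    - 1 / 2 * J ^ 3 * T ^ 3 * E * V ^ 2 + J ^ 3 * T ^ 3 * V ^ 4) * I_sq
    + J ^ 3 * T ^ 3 * V ^ 4 * (I + I ^ 2) * e2

theorem exp_two_pi_mul_I_two_I : exp (2 * Real.pi * I * (2 * I)) = exp (-4 * Real.pi) := by
  congr 1
  linear_combination 4 * Real.pi * I_sq

theorem exp_two_pi_mul_I_one_add_I : exp (2 * Real.pi * I * (1 + I)) = exp (-2 * Real.pi) := by
  -- `2πi(1+i) = -2π + 2πi`, and the period drops out.
  rw [← exp_periodic (-2 * Real.pi)]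
  congr 1
  linear_combination 2 * Real.pi * I_sq

theorem exp_two_pi_mul_I_neg_inv_two_I :
    exp (2 * Real.pi * I * (-1 / (2 * I))) = exp (-Real.pi) := by
  congr 1
  field_simp

theorem exp_two_pi_mul_I_neg_inv_one_add_I :
    exp (2 * Real.pi * I * (-1 / (1 + I))) = -exp (-Real.pi) := by
  have hw : (1 + I) ≠ 0 := fun h ↦ by simpa using congrArg im h
  have h : -1 / (1 + I) = (I - 1) / 2 := by
    rw [div_eq_iff hw]
    linear_combination (-1 / 2) * I_sq
  rw [← exp_sub_pi_mul_I, h]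
  congr 1
  linear_combination Real.pi * I_sq

theorem mainTheorem4 (k : ℕ) (hk : 1 ≤ k) :
    zetaCoeffA k ≠ 0 ∧
    Summable (lambertTerm (Complex.exp (-2 * (Real.pi : ℂ))) (-4 * (k : ℂ) - 1)) ∧
    Summable (lambertTerm (Complex.exp (-4 * (Real.pi : ℂ))) (-4 * (k : ℂ) - 1)) ∧
    riemannZeta (4 * (k : ℂ) + 1) =
      (2 * (Real.pi : ℂ)) ^ (4 * k + 1) *
          ∑ j ∈ Finset.range (k + 1),
            (-1 : ℂ) ^ (j + 1) * zetaCoeffB j k * (bernoulli (2 * j) : ℂ) *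
                (bernoulli (4 * k + 2 - 2 * j) : ℂ) /
              ((Nat.factorial (2 * j) : ℂ) * (Nat.factorial (4 * k + 2 - 2 * j) : ℂ))
        - (2 * zetaCoeffA k + 4) / zetaCoeffA k
            * lambertL (Complex.exp (-2 * (Real.pi : ℂ))) (-4 * (k : ℂ) - 1)
        + 4 / zetaCoeffA k
            * lambertL (Complex.exp (-4 * (Real.pi : ℂ))) (-4 * (k : ℂ) - 1) := by
  have ha := zetaCoeffA_ne_zero hk
  have hq : ‖exp (-(Real.pi : ℂ))‖ < 1 := by
    rw [norm_exp, neg_re, ofReal_re, Real.exp_lt_one_iff]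
    linarith [Real.pi_pos]
  have hq2 : exp (-(Real.pi : ℂ)) ^ 2 = exp (-2 * Real.pi) := by
    rw [← exp_nat_mul]
    congr 1
    push_cast
    ring
  have hq4 : exp (-(Real.pi : ℂ)) ^ 4 = exp (-4 * Real.pi) := by
    rw [← exp_nat_mul]
    congr 1
    push_cast
    ring
  refine ⟨ha, ?_, ?_, ?_⟩
  · rw [lambertTerm_neg_nat, ← hq2]
    exact summable_lambertInvPow _
      (by rw [norm_pow]; exact pow_lt_one₀ (norm_nonneg _) hq two_ne_zero)
  · rw [lambertTerm_neg_nat, ← hq4]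
    exact summable_lambertInvPow _
      (by rw [norm_pow]; exact pow_lt_one₀ (norm_nonneg _) hq four_ne_zero)
  rw [lambertL_neg_nat, lambertL_neg_nat]
  have h1 := ramanujan_formula hk (τ := 2 * I) (by simp) (by
    rw [show (2 * I) ^ 2 = -4 by linear_combination 4 * I_sq]; norm_num)
  have h2 := ramanujan_formula hk (τ := 1 + I) (by simp) (by rw [one_add_I_sq]; simp)
  have h3 := lambertInvPow_add_lambertInvPow_neg (4 * k + 1) hq
  rw [hq2, hq4] at h3
  have hp1 : (2 * I) ^ (4 * k) = 2 ^ (4 * k) := by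
    rw [mul_pow, pow_mul I, I_pow_four, one_pow, mul_one]
  have hp2 : (1 + I) ^ (4 * k) = (-4) ^ k := by
    rw [pow_mul, show (1 + I) ^ 4 = -4 by
      linear_combination ((1 + I) ^ 2 + 2 * I) * one_add_I_sq + 4 * I_sq]
  have hp3 : ((-4 : ℂ) ^ k) * (-4) ^ k = 2 ^ (4 * k) := by
    rw [← mul_pow, pow_mul]
    norm_num
  rw [exp_two_pi_mul_I_two_I, exp_two_pi_mul_I_neg_inv_two_I, hp1] at h1
  rw [exp_two_pi_mul_I_one_add_I, exp_two_pi_mul_I_neg_inv_one_add_I, hp2] at h2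
  have hsum : (∑ j ∈ Finset.range (k + 1),
            (-1 : ℂ) ^ (j + 1) * zetaCoeffB j k * (bernoulli (2 * j) : ℂ) *
                (bernoulli (4 * k + 2 - 2 * j) : ℂ) /
              ((Nat.factorial (2 * j) : ℂ) * (Nat.factorial (4 * k + 2 - 2 * j) : ℂ))) *
        zetaCoeffA k =
      -(I * (∑ j ∈ Finset.range (k + 1), bernoulliProdCoeff k j *
          ((2 * I) ^ (2 * (j : ℤ) - 1) + (2 * I) ^ (4 * (k : ℤ) + 1 - 2 * (j : ℤ)))) +
        (-4) ^ k * I * ∑ j ∈ Finset.range (k + 1), bernoulliProdCoeff k j *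
          ((1 + I) ^ (2 * (j : ℤ) - 1) + (1 + I) ^ (4 * (k : ℤ) + 1 - 2 * (j : ℤ)))) := by
    rw [Finset.sum_mul, Finset.mul_sum, Finset.mul_sum, ← Finset.sum_add_distrib,
      ← Finset.sum_neg_distrib]
    refine Finset.sum_congr rfl fun j hj ↦ ?_
    have h := zetaCoeffB_mul hk (Nat.lt_succ_iff.mp (Finset.mem_range.mp hj))
    rw [bernoulliProdCoeff]
    linear_combination ((bernoulli (2 * j) : ℂ) * (bernoulli (4 * k + 2 - 2 * j) : ℂ) /
      ((Nat.factorial (2 * j) : ℂ) * (Nat.factorial (4 * k + 2 - 2 * j) : ℂ))) * h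
  have hA : zetaCoeffA k = 2 * 2 ^ (4 * k) - (-4) ^ k - 1 := by
    rw [zetaCoeffA, pow_mul 2 2 k, ← mul_pow, pow_succ]
    norm_num
    ring
  refine mul_right_cancel₀ ha ?_
  have e : ∀ x y u v : ℂ, (x - u / zetaCoeffA k * y + 4 / zetaCoeffA k * v) * zetaCoeffA k =
      x * zetaCoeffA k - u * y + 4 * v := fun x y u v ↦ by field_simp
  rw [e, mul_assoc, hsum, hA]
  have hz : riemannZeta (4 * (k : ℂ) + 1) = riemannZeta (4 * k + 1 : ℕ) := by
    push_cast
    rfl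
  rw [hz]
  have hN : (2 : ℂ) ^ (4 * k) * (2 ^ (4 * k + 1))⁻¹ = 1 / 2 := by
    rw [pow_succ]
    field_simp
  generalize (∑ j ∈ Finset.range (k + 1), bernoulliProdCoeff k j *
          ((2 * I) ^ (2 * (j : ℤ) - 1) + (2 * I) ^ (4 * (k : ℤ) + 1 - 2 * (j : ℤ)))) = S1 at *
  generalize (∑ j ∈ Finset.range (k + 1), bernoulliProdCoeff k j *
          ((1 + I) ^ (2 * (j : ℤ) - 1) + (1 + I) ^ (4 * (k : ℤ) + 1 - 2 * (j : ℤ)))) = S2 at *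
  generalize riemannZeta (4 * k + 1 : ℕ) = z at *
  generalize lambertInvPow (4 * k + 1) (exp (-4 * Real.pi)) = F4 at *
  generalize lambertInvPow (4 * k + 1) (exp (-2 * Real.pi)) = F2 at *
  generalize lambertInvPow (4 * k + 1) (exp (-Real.pi)) = x at *
  generalize lambertInvPow (4 * k + 1) (-exp (-Real.pi)) = y at *
  generalize (2 * (Real.pi : ℂ)) ^ (4 * k + 1) = A at *
  generalize ((2 : ℂ) ^ (4 * k + 1))⁻¹ = N at *
  generalize (2 : ℂ) ^ (4 * k) = P at *
  generalize (-4 : ℂ) ^ k = W at *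
  -- Here `hp3` equalizes the factors of `x` and `y`, so that `h3` eliminates both.
  linear_combination (-1) * h1 - W * h2 - 2 * P * h3 - (z + 2 * y) * hp3 - 4 * (F2 - F4) * hN
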